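/- Let $n\ge 1$ and let $r\in\{1,\dots,n\}$ be arbitrary. Consider an urn with $n$ labelled balls $1,\dots,n$, initially uncolored, and colors $c_0,\dots,c_{n-1}$; let $A$ denote the set of balls that are uncolored at the current time. *Color assignment.* Paint ball $r$ with $c_0$ and set $i=1$; if $A\neq\emptyset$, paint a uniformly chosen ball of $A$ with $c_1$. Then, as long as $A\ne\emptyset$, repeat: draw a ball $b$ uniformly from the whole urn (with replacement); if $b\in A$, paint $b$ with $c_i$; if $b\notin A$, increase $i$ by $1$ and paint a uniformly chosen ball of $A$ with $c_i$. All choices are made independently of the past. Let $C_j$ be the sequence of balls painted with $c_j$, in the order in which they were painted ($C_j=\emptyset$ if $c_j$ is not used). *Urn-Tree.* Start with the tree $(V_T,E_T)=(\{r\},\emptyset)$. For $i=1,2,\dots$, as long as $C_i\ne\emptyset$ (which forces $i\le n-1$): write $C_i=(v_1,\dots,v_h)$, choose $u$ uniformly from $V_T$, independently of the other choices given $V_T$, and replace $V_T$ by $V_T\cup\{v_1,\dots,v_h\}$ and $E_T$ by $E_T\cup\{\{u,v_1\},\{v_1,v_2\},\dots,\{v_{h-1},v_h\}\}$. Return $(V_T,E_T)$;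 this is the tree $\mathcal T^U_{n-1}$ present after at most $n-1$ paths have been attached. **Corollary (Urn-Tree gives UST).** The random graph $\mathcal T^U_{n-1}$ returned by Urn-Tree is a uniform spanning tree of the complete graph $K_n$ on $\{1,\dots,n\}$: it equals each spanning tree of $K_n$ with probability $1/|\mathcal T_{K_n}|$, where $\mathcal T_{K_n}$ is the set of spanning trees of $K_n$, and it is a spanning tree of $K_n$ with probability one. -/

import Mathlib

/-! ### The urn and the color-assignment process

The balls are the elements of `Fin n`, so a ball is identified with the corresponding vertex. -/

/-- A state of the color-assignment process: the set `A` of uncolored balls, the index `i` of the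
current color, and for every color `c_j` the sequence `C_j` of balls painted with it, in the order
in which they were painted (`[]` for a color that is not used; in particular for `j ≥ n`). -/
structure UrnState (n : ℕ) where
  /-- the set `A` of uncolored balls -/
  uncolored : Finset (Fin n)
  /-- the index `i` of the current color -/
  color : ℕ
  /-- the sequences `C_j` -/
  seq : ℕ → List (Fin n)

namespace UrnState

variable {n : ℕ}

/-- Paint the ball `b` with the current color. -/
def paint (s : UrnState n) (b : Fin n) : UrnState n where
  uncolored := s.uncolored.erase b
  color := s.color
  seq := Function.update s.seq s.color (s.seq s.color ++ [b])

/-- Move on to the next color: `i ← i + 1`. -/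
def nextColor (s : UrnState n) : UrnState n :=
  { s with color := s.color + 1 }

/-- Paint a uniformly chosen uncolored ball with the current color (if no ball is uncolored,
there is nothing to do). -/
noncomputable def paintUniform (s : UrnState n) : PMF (UrnState n) :=
  if h : s.uncolored.Nonempty then
    (PMF.uniformOfFinset s.uncolored h).map s.paint
  else
    PMF.pure s

/-- The ball `r` is painted with `c_0`, all others are uncolored, and `i = 1`. -/
def start (r : Fin n) : UrnState n where
  uncolored := Finset.univ.erase r
  color := 1
  seq := fun j => if j = 0 then [r] else []

/-- One draw: choose a ball uniformly from the whole urn; if it is uncolored, paint it with the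
current color, and otherwise move on to the next color and paint a uniformly chosen uncolored
ball with it. -/
noncomputable def draw [NeZero n] (s : UrnState n) : PMF (UrnState n) :=
  (PMF.uniformOfFintype (Fin n)).bind fun b =>
    if b ∈ s.uncolored then PMF.pure (s.paint b) else s.nextColor.paintUniform

/-- Draw as long as there are uncolored balls, but at most `k` times. -/
noncomputable def drawLoop [NeZero n] : ℕ → UrnState n → PMF (UrnState n)
  | 0, s => PMF.pure s
  | k + 1, s => if s.uncolored.Nonempty then s.draw.bind (drawLoop k) else PMF.pure s

end UrnState

/-- The law of the sequences `C = (C_0, C_1, …)` that the color-assignment process produces on an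
urn with `n` balls and initial ball `r`. Each draw colors exactly one ball, so that the bound `n`
on the number of draws is never what stops the process. -/
noncomputable def colorAssignment {n : ℕ} [NeZero n] (r : Fin n) : PMF (ℕ → List (Fin n)) :=
  ((UrnState.start r).paintUniform.bind (UrnState.drawLoop n)).map UrnState.seq

/-! ### The Urn-Tree algorithm

A graph is recorded as the pair `(V_T, E_T)` of its vertex set and its edge set. -/

/-- The edges of the path graph along a sequence of vertices: one edge for every two adjacent
entries. -/
def pathEdges {V : Type*} [DecidableEq V] (l : List V) : Finset (Sym2 V) :=
  (List.zipWith (fun a b => s(a, b)) l l.tail).toFinset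

/-- Attach to `T = (V_T, E_T)` the path graph along the sequence `v :: l` by an edge `{u, v}`, where
the anchor `u` is chosen uniformly from `V_T` (which is never empty in the algorithm). -/
noncomputable def attachPath {V : Type*} [DecidableEq V] (T : Finset V × Finset (Sym2 V))
    (v : V) (l : List V) : PMF (Finset V × Finset (Sym2 V)) :=
  if h : T.1.Nonempty then
    (PMF.uniformOfFinset T.1 h).map fun u =>
      (T.1 ∪ (v :: l).toFinset, T.2 ∪ pathEdges (v :: l) ∪ {s(u, v)})
  else
    PMF.pure T

/-- The loop `while C_i ≠ ∅` of the algorithm, run from the index `i` and the graph `T` for at most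
`m` rounds. -/
noncomputable def urnTreeLoop {V : Type*} [DecidableEq V] (C : ℕ → List V) :
    ℕ → ℕ → Finset V × Finset (Sym2 V) → PMF (Finset V × Finset (Sym2 V))
  | 0, _, T => PMF.pure T
  | m + 1, i, T =>
    match C i with
    | [] => PMF.pure T
    | v :: l => (attachPath T v l).bind (urnTreeLoop C m (i + 1))

/-- The law of the random tree `T^U_i`: the color-assignment process on `n` balls with initial ball
`r` is run, and then Urn-Tree is run on its outcome, from the one-vertex tree `({r}, ∅)`, until the
`i`-th path has been attached (or the colors in use are exhausted). Colors beyond `c_{n-1}` are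
never used, so `T^U_{n-1}` is the tree that the algorithm returns. -/
noncomputable def urnTree {n : ℕ} [NeZero n] (r : Fin n) (i : ℕ) :
    PMF (Finset (Fin n) × Finset (Sym2 (Fin n))) :=
  (colorAssignment r).bind fun C => urnTreeLoop C i 1 ({r}, ∅)

/-! ### Uniform spanning trees -/

/-- The set of spanning trees `(V_T, E_T)` of a finite graph `G`: all vertices, and edges of `G` that
form a tree on them. -/
def spanningTrees {V : Type*} [Fintype V] (G : SimpleGraph V) :
    Set (Finset V × Finset (Sym2 V)) :=
  {T | T.1 = Finset.univ ∧ (T.2 : Set (Sym2 V)) ⊆ G.edgeSet ∧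
    (SimpleGraph.fromEdgeSet (T.2 : Set (Sym2 V))).IsTree}

open Classical in
/-- `μ` is the law of a uniform spanning tree of `G`: every spanning tree has probability
one over the number of spanning trees, and everything else has probability zero. -/
def IsUniformSpanningTree {V : Type*} [Fintype V] (G : SimpleGraph V)
    (μ : PMF (Finset V × Finset (Sym2 V))) : Prop :=
  ∀ T, μ T = if T ∈ spanningTrees G then ((spanningTrees G).ncard : ENNReal)⁻¹ else 0

/-! The anchors do not influence the colors, so each anchor can be drawn at the moment its path is
opened. The algorithm then becomes a Markov chain, `treeGrow`, that adds one leaf per step: a fresh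
ball hangs from the latest vertex `x`, while a repeated ball makes a uniform new vertex hang from a
uniform old one (`drawLoop_bind_treeLaw`, `urnTree_eq_bind_treeGrow`).

Fix a spanning tree rooted at `r`, and let `D v` count the descendants of `v`, itself included. If
the chain has built the part of this tree on an ancestor-closed set `S` and is at `x`, it completes
the tree with probability `n^(-|Sᶜ|) * (1 + ∑ D v)`, the sum being over the children `v` of `x`
outside `S` (`treeGrow_apply_parentEdges`). Indeed, a correct next leaf `v` leads to the value
`n^(-|Sᶜ|+1) * D v`. It has weight `1/n` through a fresh draw if its parent is `x`, and weight
`1/(n|Sᶜ|)` through a repeated draw if its parent is anywhere in `S`. The branches leaving `S`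
partition `Sᶜ` (`sum_descendants_boundary`), so the repeated draws contribute exactly the summand
`1`.

The first leaf is uniform among the `n - 1` vertices other than `r`, and the branches at `r` have
total size `n - 1`; hence every spanning tree has probability `n^(-(n-2))`. Constancy is enough,
without counting trees (`IsUniformSpanningTree.of_const`). -/

namespace PMF

theorem bind_congr_of_mem_support {α β : Type*} {p : PMF α} {f g : α → PMF β}
    (h : ∀ a ∈ p.support, f a = g a) : p.bind f = p.bind g := by
  ext b
  simp only [bind_apply]
  refine tsum_congr fun a => ?_
  by_cases ha : p a = 0
  · simp [ha]
  · rw [h a ((mem_support_iff _ _).2 ha)]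

theorem uniformOfFinset_bind_apply {α β : Type*} (s : Finset α) (hs : s.Nonempty) (f : α → PMF β)
    (b : β) : (uniformOfFinset s hs).bind f b = (s.card : ENNReal)⁻¹ * ∑ a ∈ s, f a b := by
  rw [bind_apply, tsum_eq_sum (s := s), Finset.mul_sum]
  · exact Finset.sum_congr rfl fun a ha => by rw [uniformOfFinset_apply_of_mem hs ha]
  · intro a ha
    rw [uniformOfFinset_apply_of_notMem hs ha, zero_mul]

end PMF

theorem IsUniformSpanningTree.of_const {V : Type*} [Fintype V] {G : SimpleGraph V}
    {μ : PMF (Finset V × Finset (Sym2 V))} (c : ENNReal)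
    (h : ∀ T ∈ spanningTrees G, μ T = c) (h0 : ∀ T ∉ spanningTrees G, μ T = 0) :
    IsUniformSpanningTree G μ := by
  classical
  have hfin : (spanningTrees G).Finite := Set.toFinite _
  have hsum : c * ((spanningTrees G).ncard : ENNReal) = 1 := by
    rw [← μ.tsum_coe, tsum_eq_sum (s := hfin.toFinset) fun T hT => h0 T (by simpa using hT),
      Finset.sum_congr rfl fun T hT => h T (by simpa using hT), Finset.sum_const,
      Set.ncard_eq_toFinset_card _ hfin, nsmul_eq_mul, mul_comm]
  intro T
  split_ifs with hT
  · rw [h T hT]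
    exact ENNReal.eq_inv_of_mul_eq_one_left hsum
  · exact h0 T hT

/-! ### Attaching paths, and growth leaf by leaf -/

section Grow

variable {V : Type*} [DecidableEq V]

/-- Attach the vertex `v` to the graph `T` by the edge `{u, v}`. -/
def addLeaf (T : Finset V × Finset (Sym2 V)) (u v : V) : Finset V × Finset (Sym2 V) :=
  (insert v T.1, insert s(u, v) T.2)

theorem attachPath_nil {T : Finset V × Finset (Sym2 V)} (hT : T.1.Nonempty) (v : V) :
    attachPath T v [] = (PMF.uniformOfFinset T.1 hT).map fun u => addLeaf T u v := by
  rw [attachPath, dif_pos hT]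
  congr 1
  funext u
  ext a <;> simp [addLeaf, pathEdges, or_comm]

theorem pathEdges_concat {l : List V} {x : V} (hx : l.getLast? = some x) (b : V) :
    pathEdges (l ++ [b]) = insert s(x, b) (pathEdges l) := by
  induction l with
  | nil => simp at hx
  | cons a l ih =>
    cases l with
    | nil =>
      obtain rfl : a = x := by simpa using hx
      simp [pathEdges]
    | cons c l =>
      have := ih (by simpa using hx)
      simp only [pathEdges, List.cons_append, List.tail_cons, List.zipWith_cons_cons,
        List.toFinset_cons] at this ⊢
      rw [this, Finset.insert_comm]

theorem attachPath_concat {T : Finset V × Finset (Sym2 V)} (hT : T.1.Nonempty) {v x : V}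
    {l : List V} (hx : (v :: l).getLast? = some x) (b : V) :
    attachPath T v (l ++ [b]) = (attachPath T v l).map fun T' => addLeaf T' x b := by
  rw [attachPath, attachPath, dif_pos hT, dif_pos hT, PMF.map_comp]
  congr 1
  funext u
  have := pathEdges_concat hx b
  rw [List.cons_append] at this
  simp only [Function.comp_apply, addLeaf, this]
  ext a <;> simp
  tauto

theorem subset_of_mem_support_attachPath {T T' : Finset V × Finset (Sym2 V)} {v : V} {l : List V}
    (h : T' ∈ (attachPath T v l).support) : T.1 ⊆ T'.1 := by
  rw [attachPath] at h
  split_ifs at h with hT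
  · obtain ⟨u, -, rfl⟩ := (PMF.mem_support_map_iff _ _ _).1 h
    exact Finset.subset_union_left
  · rw [PMF.support_pure, Set.mem_singleton_iff] at h
    rw [h]

/-- Attach a path that may be empty. -/
noncomputable def attachList (T : Finset V × Finset (Sym2 V)) :
    List V → PMF (Finset V × Finset (Sym2 V))
  | [] => PMF.pure T
  | v :: l => attachPath T v l

theorem attachList_concat {T : Finset V × Finset (Sym2 V)} (hT : T.1.Nonempty) {x : V}
    {l : List V} (hx : l.getLast? = some x) (b : V) :
    attachList T (l ++ [b]) = (attachList T l).map fun T' => addLeaf T' x b := by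
  cases l with
  | nil => simp at hx
  | cons v l => exact attachPath_concat hT hx b

theorem urnTreeLoop_of_nil {C : ℕ → List V} {i : ℕ} (h : C i = []) (m : ℕ)
    (T : Finset V × Finset (Sym2 V)) : urnTreeLoop C m i T = PMF.pure T := by
  cases m with
  | zero => rfl
  | succ m => rw [urnTreeLoop, h]

/-- Peels off the last round instead of the first, since painting a ball changes only the last path.
-/
theorem urnTreeLoop_succ {C : ℕ → List V} {i m : ℕ} (h : ∀ j, i ≤ j → j < i + m → C j ≠ [])
    (T : Finset V × Finset (Sym2 V)) :
    urnTreeLoop C (m + 1) i T =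
      (urnTreeLoop C m i T).bind fun T' => attachList T' (C (i + m)) := by
  induction m generalizing i T with
  | zero =>
    rw [urnTreeLoop, urnTreeLoop, PMF.pure_bind, Nat.add_zero]
    cases C i with
    | nil => rfl
    | cons v l =>
      simp only [attachList]
      exact (PMF.bind_congr_of_mem_support fun _ _ => rfl).trans (PMF.bind_pure _)
  | succ m ih =>
    rw [urnTreeLoop, urnTreeLoop]
    cases hC : C i with
    | nil => exact absurd hC (h i le_rfl (by omega))
    | cons v l =>
      simp only [PMF.bind_bind]
      congr 1
      funext T'
      rw [ih (fun j h1 h2 => h j (by omega) (by omega)), show i + 1 + m = i + (m + 1) by omega]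

theorem urnTreeLoop_congr {C C' : ℕ → List V} {i m : ℕ} (h : ∀ j, i ≤ j → j < i + m → C j = C' j)
    (T : Finset V × Finset (Sym2 V)) : urnTreeLoop C m i T = urnTreeLoop C' m i T := by
  induction m generalizing i T with
  | zero => rfl
  | succ m ih =>
    rw [urnTreeLoop, urnTreeLoop, h i le_rfl (by omega)]
    cases C' i with
    | nil => rfl
    | cons v l =>
      simp only
      congr 1
      funext T'
      exact ih (fun j h1 h2 => h j (by omega) (by omega)) T'

theorem urnTreeLoop_of_le {C : ℕ → List V} {i m M : ℕ} (hM : m ≤ M) (h : C (i + m) = [])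
    (T : Finset V × Finset (Sym2 V)) : urnTreeLoop C M i T = urnTreeLoop C m i T := by
  induction m generalizing i M T with
  | zero => exact urnTreeLoop_of_nil h M T
  | succ m ih =>
    obtain ⟨M, rfl⟩ : ∃ k, M = k + 1 := ⟨M - 1, by omega⟩
    rw [urnTreeLoop, urnTreeLoop]
    cases C i with
    | nil => rfl
    | cons v l =>
      simp only
      congr 1
      funext T'
      exact ih (by omega) (by rwa [show i + 1 + m = i + (m + 1) by omega]) T'

theorem subset_of_mem_support_urnTreeLoop {C : ℕ → List V} {i m : ℕ}
    {T T' : Finset V × Finset (Sym2 V)} (h : T' ∈ (urnTreeLoop C m i T).support) :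
    T.1 ⊆ T'.1 := by
  induction m generalizing i T with
  | zero =>
    rw [urnTreeLoop, PMF.support_pure, Set.mem_singleton_iff] at h
    rw [h]
  | succ m ih =>
    rw [urnTreeLoop] at h
    split at h
    · rw [PMF.support_pure, Set.mem_singleton_iff] at h
      rw [h]
    · obtain ⟨T₁, h1, h2⟩ := (PMF.mem_support_bind_iff _ _ _).1 h
      exact (subset_of_mem_support_attachPath h1).trans (ih h2)

variable [Fintype V] [Nonempty V]

/-- Grow the graph `T`, whose most recent vertex is `x`, in at most `k` steps: draw a vertex
uniformly; if it is new, attach it to `x`, and otherwise attach a uniformly chosen new vertex to a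
uniformly chosen old one. -/
noncomputable def treeGrow :
    ℕ → V → Finset V × Finset (Sym2 V) → PMF (Finset V × Finset (Sym2 V))
  | 0, _, T => PMF.pure T
  | k + 1, x, T =>
    if h : (T.1ᶜ).Nonempty then
      (PMF.uniformOfFintype V).bind fun b =>
        if b ∈ T.1ᶜ then treeGrow k b (addLeaf T x b)
        else (PMF.uniformOfFinset T.1ᶜ h).bind fun v => (attachPath T v []).bind (treeGrow k v)
    else PMF.pure T

theorem treeGrow_of_compl_eq_empty {T : Finset V × Finset (Sym2 V)} (h : T.1ᶜ = ∅) (k : ℕ) (x : V) :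
    treeGrow k x T = PMF.pure T := by
  cases k with
  | zero => rfl
  | succ k => rw [treeGrow, dif_neg (by simp [h])]

theorem treeGrow_succ {T : Finset V × Finset (Sym2 V)} {A : Finset V} (h : T.1ᶜ = A)
    (hA : A.Nonempty) (k : ℕ) (x : V) :
    treeGrow (k + 1) x T = (PMF.uniformOfFintype V).bind fun b =>
        if b ∈ A then treeGrow k b (addLeaf T x b)
        else (PMF.uniformOfFinset A hA).bind fun v => (attachPath T v []).bind (treeGrow k v) := by
  subst h
  rw [treeGrow, dif_pos hA]

end Grow

/-! ### The urn process as leaf-by-leaf growth -/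

namespace UrnState

variable {n : ℕ}

/-- The law of the tree built from the balls that are colored so far. -/
noncomputable def treeLaw (r : Fin n) (s : UrnState n) :
    PMF (Finset (Fin n) × Finset (Sym2 (Fin n))) :=
  urnTreeLoop s.seq (n - 1) 1 ({r}, ∅)

/-- Properties of the states visited by the color assignment, `x` being the ball painted last. -/
structure Coherent (r : Fin n) (s : UrnState n) (x : Fin n) : Prop where
  color_pos : 1 ≤ s.color
  seq_ne_nil : ∀ j, 1 ≤ j → j ≤ s.color → s.seq j ≠ []
  seq_eq_nil : ∀ j, s.color < j → s.seq j = []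
  getLast : (s.seq s.color).getLast? = some x
  card_le : s.color + s.uncolored.card + 1 ≤ n
  compl_eq : ∀ T ∈ (treeLaw r s).support, T.1ᶜ = s.uncolored

namespace Coherent

variable {r x : Fin n} {s : UrnState n}

/-- By `card_le` the current color is at most `n - 1`, so the cap on the rounds cuts off no path. -/
theorem treeLaw_eq (h : Coherent r s x) :
    treeLaw r s = urnTreeLoop s.seq s.color 1 ({r}, ∅) := by
  have := h.card_le
  exact urnTreeLoop_of_le (by omega) (h.seq_eq_nil _ (by omega)) _

theorem treeLaw_paint (h : Coherent r s x) (b : Fin n) :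
    treeLaw r (s.paint b) = (treeLaw r s).map fun T => addLeaf T x b := by
  have hc := h.card_le
  obtain ⟨m, hm⟩ : ∃ m, s.color = m + 1 := ⟨s.color - 1, by have := h.color_pos; omega⟩
  have hl := h.getLast
  have h1 : treeLaw r (s.paint b) = urnTreeLoop (s.paint b).seq s.color 1 ({r}, ∅) := by
    refine urnTreeLoop_of_le (by omega) ?_ _
    simp only [paint]
    rw [Function.update_of_ne (by omega)]
    exact h.seq_eq_nil _ (by omega)
  have hne : ∀ j, 1 ≤ j → j < 1 + m → s.seq j ≠ [] := fun j h1 h2 => h.seq_ne_nil j h1 (by omega)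
  have hag : ∀ j, 1 ≤ j → j < 1 + m → (s.paint b).seq j = s.seq j := fun j h1 h2 => by
    simp only [paint]
    rw [Function.update_of_ne (by omega)]
  rw [h1, h.treeLaw_eq, hm, urnTreeLoop_succ fun j h1 h2 => by rw [hag j h1 h2]; exact hne j h1 h2,
    urnTreeLoop_succ hne, urnTreeLoop_congr hag, PMF.map_bind]
  refine PMF.bind_congr_of_mem_support fun T hT => ?_
  have hcol : 1 + m = s.color := by omega
  rw [hcol, ← attachList_concat ⟨r, subset_of_mem_support_urnTreeLoop hT (by simp)⟩ hl]
  simp [paint]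

theorem treeLaw_nextColor_paint (h : Coherent r s x) (hA : s.uncolored.Nonempty) (b : Fin n) :
    treeLaw r (s.nextColor.paint b) = (treeLaw r s).bind fun T => attachPath T b [] := by
  have hc := h.card_le
  -- With a ball still uncolored, `card_le` leaves room for one more color below `n`.
  have := hA.card_pos
  have h1 : treeLaw r (s.nextColor.paint b) =
      urnTreeLoop (s.nextColor.paint b).seq (s.color + 1) 1 ({r}, ∅) := by
    refine urnTreeLoop_of_le (by omega) ?_ _
    simp only [paint, nextColor]
    rw [Function.update_of_ne (by omega)]
    exact h.seq_eq_nil _ (by omega)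
  have hag : ∀ j, 1 ≤ j → j < 1 + s.color → (s.nextColor.paint b).seq j = s.seq j :=
    fun j h1 h2 => by
      simp only [paint, nextColor]
      rw [Function.update_of_ne (by omega)]
  rw [h1, h.treeLaw_eq, urnTreeLoop_succ fun j h1 h2 => by
    rw [hag j h1 h2]; exact h.seq_ne_nil j h1 (by omega), urnTreeLoop_congr hag]
  congr 1
  funext T
  have : (s.nextColor.paint b).seq (1 + s.color) = [b] := by
    simp [paint, nextColor, add_comm 1, h.seq_eq_nil]
  rw [this, attachList]

theorem paint (h : Coherent r s x) {b : Fin n} (hb : b ∈ s.uncolored) :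
    Coherent r (s.paint b) b where
  color_pos := h.color_pos
  seq_ne_nil j h1 h2 := by
    simp only [UrnState.paint] at h2 ⊢
    by_cases hj : j = s.color
    · simp [hj]
    · rw [Function.update_of_ne hj]
      exact h.seq_ne_nil j h1 h2
  seq_eq_nil j hj := by
    simp only [UrnState.paint] at hj ⊢
    rw [Function.update_of_ne (by omega)]
    exact h.seq_eq_nil j hj
  getLast := by simp [UrnState.paint]
  card_le := by
    have := h.card_le
    have := Finset.card_erase_add_one hb
    simp only [UrnState.paint]
    omega
  compl_eq T hT := by
    rw [h.treeLaw_paint] at hT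
    obtain ⟨T₁, hT₁, rfl⟩ := (PMF.mem_support_map_iff _ _ _).1 hT
    simp only [addLeaf, UrnState.paint, ← h.compl_eq T₁ hT₁]
    ext a
    simp

theorem nextColor_paint (h : Coherent r s x) {b : Fin n} (hb : b ∈ s.uncolored) :
    Coherent r (s.nextColor.paint b) b where
  color_pos := by simp [UrnState.paint, nextColor]
  seq_ne_nil j h1 h2 := by
    simp only [UrnState.paint, nextColor] at h2 ⊢
    by_cases hj : j = s.color + 1
    · simp [hj]
    · rw [Function.update_of_ne hj]
      exact h.seq_ne_nil j h1 (by omega)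
  seq_eq_nil j hj := by
    simp only [UrnState.paint, nextColor] at hj ⊢
    rw [Function.update_of_ne (by omega)]
    exact h.seq_eq_nil j (by omega)
  getLast := by simp [UrnState.paint, nextColor]
  card_le := by
    have := h.card_le
    have := Finset.card_erase_add_one hb
    simp only [UrnState.paint, nextColor]
    omega
  compl_eq T hT := by
    rw [h.treeLaw_nextColor_paint ⟨b, hb⟩] at hT
    obtain ⟨T₁, hT₁, hT⟩ := (PMF.mem_support_bind_iff _ _ _).1 hT
    rw [attachPath_nil ⟨r, subset_of_mem_support_urnTreeLoop hT₁ (by simp)⟩] at hT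
    obtain ⟨u, -, rfl⟩ := (PMF.mem_support_map_iff _ _ _).1 hT
    simp only [addLeaf, UrnState.paint, nextColor, ← h.compl_eq T₁ hT₁]
    ext a
    simp

/-- The anchors of the existing paths are independent of the remaining draws, so the two may be
sampled in either order. -/
theorem drawLoop_bind_treeLaw [NeZero n] (h : Coherent r s x) (k : ℕ) :
    (drawLoop k s).bind (treeLaw r) = (treeLaw r s).bind (treeGrow k x) := by
  induction k generalizing s x with
  | zero =>
    rw [drawLoop, PMF.pure_bind]
    exact (PMF.bind_pure _).symm
  | succ k ih =>
    rw [drawLoop]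
    split_ifs with hA
    -- Every possible tree misses exactly the uncolored balls, so the next draw does not depend on
    -- `T` and can be moved in front of it.
    · rw [PMF.bind_congr_of_mem_support fun T hT => treeGrow_succ (h.compl_eq T hT) hA k x,
        PMF.bind_comm, draw, PMF.bind_bind, PMF.bind_bind]
      congr 1
      funext b
      split_ifs with hb
      · rw [PMF.pure_bind, ih (h.paint hb), h.treeLaw_paint, PMF.bind_map]
        rfl
      · rw [PMF.bind_comm, paintUniform, dif_pos (show s.nextColor.uncolored.Nonempty from hA),
          PMF.bind_map]
        refine PMF.bind_congr_of_mem_support fun v hv => ?_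
        have hv : v ∈ s.uncolored := by
          have := (PMF.mem_support_uniformOfFinset_iff (s := s.nextColor.uncolored) hA v).1 hv
          exact this
        rw [Function.comp_apply, ih (h.nextColor_paint hv), h.treeLaw_nextColor_paint hA,
          PMF.bind_bind]
    · rw [PMF.pure_bind, PMF.bind_congr_of_mem_support fun T hT => treeGrow_of_compl_eq_empty
        ((h.compl_eq T hT).trans (Finset.not_nonempty_iff_eq_empty.1 hA)) _ _, PMF.bind_pure]

end Coherent

theorem treeLaw_start_paint {r v : Fin n} (hv : v ≠ r) :
    treeLaw r ((start r).paint v) = (PMF.pure (addLeaf ({r}, ∅) r v)) := by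
  have h1 : treeLaw r ((start r).paint v) = urnTreeLoop ((start r).paint v).seq 1 1 ({r}, ∅) := by
    refine urnTreeLoop_of_le ?_ ?_ _
    · have : Nontrivial (Fin n) := ⟨v, r, hv⟩
      have := Fin.nontrivial_iff_two_le.1 this
      omega
    · simp [start, paint]
  have h2 : ((start r).paint v).seq 1 = [v] := by simp [start, paint]
  rw [h1, urnTreeLoop, h2]
  simp only
  rw [attachPath_nil (by simp), ← PMF.bind_pure_comp, PMF.bind_bind]
  ext T
  simp only [Function.comp_apply, PMF.pure_bind, urnTreeLoop]
  rw [PMF.uniformOfFinset_bind_apply]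
  simp

theorem coherent_start_paint {r v : Fin n} (hv : v ≠ r) : Coherent r ((start r).paint v) v where
  color_pos := le_rfl
  seq_ne_nil j h1 h2 := by
    obtain rfl : j = 1 := le_antisymm h2 h1
    simp [start, paint]
  seq_eq_nil j hj := by
    simp only [paint, start] at hj ⊢
    rw [Function.update_of_ne (by omega), if_neg (by omega)]
  getLast := by simp [paint, start]
  card_le := by
    have h1 := Finset.card_erase_add_one (Finset.mem_univ r)
    have h2 := Finset.card_erase_add_one (Finset.mem_erase.2 ⟨hv, Finset.mem_univ v⟩)
    rw [Finset.card_univ, Fintype.card_fin] at h1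
    simp only [paint, start]
    omega
  compl_eq T hT := by
    rw [treeLaw_start_paint hv, PMF.support_pure, Set.mem_singleton_iff] at hT
    subst hT
    ext a
    simp [paint, start, addLeaf]

end UrnState

theorem urnTree_eq_bind_treeGrow {n : ℕ} [NeZero n] (r : Fin n)
    (h : (Finset.univ.erase r).Nonempty) :
    urnTree r (n - 1) = (PMF.uniformOfFinset (Finset.univ.erase r) h).bind fun v =>
      treeGrow n v (addLeaf ({r}, ∅) r v) := by
  rw [urnTree, colorAssignment, PMF.bind_map, PMF.bind_bind, UrnState.paintUniform,
    dif_pos (show (UrnState.start r).uncolored.Nonempty from h), PMF.bind_map]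
  refine PMF.bind_congr_of_mem_support fun v hv => ?_
  have hv : v ≠ r := by
    have := (PMF.mem_support_uniformOfFinset_iff (s := Finset.univ.erase r) h v).1 hv
    exact Finset.ne_of_mem_erase this
  have := (UrnState.coherent_start_paint hv).drawLoop_bind_treeLaw n
  rw [UrnState.treeLaw_start_paint hv, PMF.pure_bind] at this
  exact this

theorem urnTree_eq_pure {n : ℕ} [NeZero n] (r : Fin n) (h : ¬(Finset.univ.erase r).Nonempty) :
    urnTree r (n - 1) = PMF.pure ({r}, ∅) := by
  have hn : n = 1 := by
    have h1 := Finset.card_erase_add_one (Finset.mem_univ r)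
    rw [Finset.not_nonempty_iff_eq_empty.1 h] at h1
    simpa using h1.symm
  have : (fun C => urnTreeLoop C (n - 1) 1 ({r}, ∅)) =
      fun _ : ℕ → List (Fin n) => PMF.pure ({r}, ∅) := by
    funext C
    rw [show n - 1 = 0 by omega, urnTreeLoop]
  rw [urnTree, this, PMF.bind_const]

/-! ### Growth ends in spanning trees; one-step probabilities -/

section SpanningTreeSupport

variable {V : Type*}

/-- `T` is a loopless graph on `T.1`, connected to `r` and with fewer edges than vertices. -/
structure IsGrownFrom (r : V) (T : Finset V × Finset (Sym2 V)) : Prop where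
  reachable : ∀ v ∈ T.1, (SimpleGraph.fromEdgeSet (T.2 : Set (Sym2 V))).Reachable r v
  card_lt : T.2.card < T.1.card
  not_isDiag : ∀ e ∈ T.2, ¬e.IsDiag

theorem IsGrownFrom.singleton (r : V) : IsGrownFrom r ({r}, ∅) where
  reachable v hv := by
    rw [Finset.mem_singleton.1 hv]
  card_lt := by simp
  not_isDiag := by simp

theorem IsGrownFrom.mem_spanningTrees [Fintype V] {r : V} {T : Finset V × Finset (Sym2 V)}
    (h : IsGrownFrom r T) (hT : T.1 = Finset.univ) : T ∈ spanningTrees (⊤ : SimpleGraph V) := by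
  have hset : (SimpleGraph.fromEdgeSet (T.2 : Set (Sym2 V))).edgeSet = T.2 := by
    rw [SimpleGraph.edgeSet_fromEdgeSet, sdiff_eq_left, Set.disjoint_left]
    exact fun e he => h.not_isDiag e he
  have hconn : (SimpleGraph.fromEdgeSet (T.2 : Set (Sym2 V))).Connected :=
    SimpleGraph.connected_iff_exists_forall_reachable _ |>.2
      ⟨r, fun v => h.reachable v (by simp [hT])⟩
  refine ⟨hT, fun e he => ?_, SimpleGraph.isTree_iff_connected_and_card.2 ⟨hconn, ?_⟩⟩
  · rw [SimpleGraph.edgeSet_top]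
    exact h.not_isDiag e he
  · refine le_antisymm ?_ hconn.card_vert_le_card_edgeSet_add_one
    rw [hset, Nat.card_coe_set_eq, Set.ncard_coe_finset, Nat.card_eq_fintype_card,
      ← Finset.card_univ, ← hT]
    exact h.card_lt

variable [DecidableEq V]

theorem IsGrownFrom.addLeaf {r u v : V} {T : Finset V × Finset (Sym2 V)} (h : IsGrownFrom r T)
    (hu : u ∈ T.1) (hv : v ∉ T.1) : IsGrownFrom r (addLeaf T u v) where
  reachable w hw := by
    have hmono : SimpleGraph.fromEdgeSet (T.2 : Set (Sym2 V)) ≤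
        SimpleGraph.fromEdgeSet ((_root_.addLeaf T u v).2 : Set (Sym2 V)) :=
      SimpleGraph.fromEdgeSet_mono (by simp [_root_.addLeaf])
    rcases Finset.mem_insert.1 hw with rfl | hw
    · refine ((h.reachable u hu).mono hmono).trans (SimpleGraph.Adj.reachable ?_)
      rw [SimpleGraph.fromEdgeSet_adj]
      exact ⟨by simp [_root_.addLeaf], fun e => hv (e ▸ hu)⟩
    · exact (h.reachable w hw).mono hmono
  card_lt := by
    have := h.card_lt
    have := Finset.card_insert_le s(u, v) T.2
    simp only [_root_.addLeaf]
    rw [Finset.card_insert_of_notMem hv]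
    omega
  not_isDiag e he := by
    rcases Finset.mem_insert.1 he with rfl | he
    · rw [Sym2.mk_isDiag_iff]
      rintro rfl
      exact hv hu
    · exact h.not_isDiag e he

variable [Fintype V] [Nonempty V]

/-- One step of `treeGrow` attaches a new vertex to an old one. -/
theorem mem_support_treeGrow_succ {k : ℕ} {x : V} {T T' : Finset V × Finset (Sym2 V)}
    (hx : x ∈ T.1) (hT : (T.1ᶜ).Nonempty) (h : T' ∈ (treeGrow (k + 1) x T).support) :
    ∃ u ∈ T.1, ∃ v ∉ T.1, T' ∈ (treeGrow k v (addLeaf T u v)).support := by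
  rw [treeGrow_succ rfl hT, PMF.mem_support_bind_iff] at h
  obtain ⟨b, -, h⟩ := h
  split_ifs at h with hb
  · exact ⟨x, hx, b, Finset.mem_compl.1 hb, h⟩
  · obtain ⟨v, hv, h⟩ := (PMF.mem_support_bind_iff _ _ _).1 h
    rw [attachPath_nil ⟨x, hx⟩, PMF.bind_map] at h
    obtain ⟨u, hu, h⟩ := (PMF.mem_support_bind_iff _ _ _).1 h
    exact ⟨u, (PMF.mem_support_uniformOfFinset_iff _ _).1 hu, v,
      Finset.mem_compl.1 ((PMF.mem_support_uniformOfFinset_iff _ _).1 hv), h⟩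

theorem mem_spanningTrees_of_mem_support_treeGrow {k : ℕ} {r x : V}
    {T T' : Finset V × Finset (Sym2 V)} (hx : x ∈ T.1) (hk : T.1ᶜ.card ≤ k)
    (hT : IsGrownFrom r T) (h : T' ∈ (treeGrow k x T).support) :
    T' ∈ spanningTrees (⊤ : SimpleGraph V) := by
  induction k generalizing x T with
  | zero =>
    rw [treeGrow, PMF.support_pure, Set.mem_singleton_iff] at h
    rw [h]
    exact hT.mem_spanningTrees (by simpa using hk)
  | succ k ih =>
    by_cases hne : (T.1ᶜ).Nonempty
    · obtain ⟨u, hu, v, hv, h⟩ := mem_support_treeGrow_succ hx hne h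
      refine ih (by simp [addLeaf]) ?_ (hT.addLeaf hu hv) h
      simp only [addLeaf, Finset.compl_insert]
      rw [Finset.card_erase_of_mem (Finset.mem_compl.2 hv)]
      omega
    · rw [Finset.not_nonempty_iff_eq_empty] at hne
      rw [treeGrow_of_compl_eq_empty hne, PMF.support_pure, Set.mem_singleton_iff] at h
      rw [h]
      exact hT.mem_spanningTrees (by simpa using hne)

theorem subset_of_mem_support_treeGrow {k : ℕ} {x : V} {T T' : Finset V × Finset (Sym2 V)}
    (hx : x ∈ T.1) (h : T' ∈ (treeGrow k x T).support) : T.2 ⊆ T'.2 := by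
  induction k generalizing x T with
  | zero =>
    rw [treeGrow, PMF.support_pure, Set.mem_singleton_iff] at h
    rw [h]
  | succ k ih =>
    by_cases hne : (T.1ᶜ).Nonempty
    · obtain ⟨u, hu, v, hv, h⟩ := mem_support_treeGrow_succ hx hne h
      exact (Finset.subset_insert _ _).trans (ih (by simp [addLeaf]) h)
    · rw [Finset.not_nonempty_iff_eq_empty] at hne
      rw [treeGrow_of_compl_eq_empty hne, PMF.support_pure, Set.mem_singleton_iff] at h
      rw [h]

theorem treeGrow_succ_apply {k : ℕ} {x : V} {T : Finset V × Finset (Sym2 V)} (hx : x ∈ T.1)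
    (hT : (T.1ᶜ).Nonempty) (T' : Finset V × Finset (Sym2 V)) :
    treeGrow (k + 1) x T T' = (Fintype.card V : ENNReal)⁻¹ *
      (∑ v ∈ T.1ᶜ, treeGrow k v (addLeaf T x v) T' +
        (T.1ᶜ.card : ENNReal)⁻¹ * ∑ v ∈ T.1ᶜ, ∑ u ∈ T.1, treeGrow k v (addLeaf T u v) T') := by
  have hcard : (T.1.card : ENNReal) ≠ 0 := by
    simpa using Finset.ne_empty_of_mem hx
  have hne : T.1.Nonempty := ⟨x, hx⟩
  have h1 : ∀ v, (attachPath T v []).bind (treeGrow k v) T' =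
      (T.1.card : ENNReal)⁻¹ * ∑ u ∈ T.1, treeGrow k v (addLeaf T u v) T' := fun v => by
    rw [attachPath_nil hne, PMF.bind_map, PMF.uniformOfFinset_bind_apply]
    rfl
  -- The number of old balls that may be drawn cancels the probability of a given anchor.
  have h2 : ∀ c : ENNReal, ∑ b ∈ T.1, (T.1.card : ENNReal)⁻¹ * c = c := fun c => by
    rw [Finset.sum_const, nsmul_eq_mul, ← mul_assoc, ENNReal.mul_inv_cancel hcard (by simp),
      one_mul]
  rw [treeGrow_succ rfl hT, PMF.bind_apply, tsum_fintype]
  simp only [PMF.uniformOfFintype_apply]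
  rw [← Finset.mul_sum, ← Finset.sum_compl_add_sum T.1]
  congr 2
  · exact Finset.sum_congr rfl fun b hb => by rw [if_pos hb]
  · refine Eq.trans (Finset.sum_congr rfl fun b hb => ?_) (h2 _)
    rw [if_neg (by simpa using hb), PMF.uniformOfFinset_bind_apply,
      Finset.sum_congr rfl fun v _ => h1 v, ← Finset.mul_sum, mul_left_comm]

end SpanningTreeSupport

/-! ### The probability of completing a given rooted tree -/

section RootedTree

variable {V : Type*} [Fintype V] [DecidableEq V]

/-- `p` is the parent function of a tree with root `r`, whose vertices are graded by `d`. -/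
def IsParent (r : V) (p : V → V) (d : V → ℕ) : Prop :=
  ∀ v, v ≠ r → d (p v) + 1 = d v

/-- The edges to their parents of the vertices in `S`. -/
def parentEdges (r : V) (p : V → V) (S : Finset V) : Finset (Sym2 V) :=
  (S.erase r).image fun v => s(v, p v)

/-- The parent is the next vertex on a geodesic to `r`. The parent edges are distinct and as
numerous as the edges of the tree, so they are all of them. -/
theorem exists_parent_of_mem_spanningTrees {T : Finset V × Finset (Sym2 V)}
    (h : T ∈ spanningTrees (⊤ : SimpleGraph V)) (r : V) :
    ∃ p d, IsParent r p d ∧ T = (Finset.univ, parentEdges r p Finset.univ) := by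
  obtain ⟨h1, h2, h3⟩ := h
  set G := SimpleGraph.fromEdgeSet (T.2 : Set (Sym2 V)) with hG
  have hex : ∀ v, ∃ w, v ≠ r → G.Adj v w ∧ G.dist w r + 1 = G.dist v r := by
    intro v
    by_cases hv : v = r
    · exact ⟨v, fun h => absurd hv h⟩
    obtain ⟨q, hq⟩ := h3.connected.exists_walk_length_eq_dist v r
    cases q with
    | nil => exact absurd rfl hv
    | @cons _ w _ hadj q =>
      refine ⟨w, fun _ => ⟨hadj, ?_⟩⟩
      rw [SimpleGraph.Walk.length_cons] at hq
      have h4 := SimpleGraph.dist_le q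
      obtain ⟨q', hq'⟩ := h3.connected.exists_walk_length_eq_dist w r
      have h5 := SimpleGraph.dist_le (SimpleGraph.Walk.cons hadj q')
      rw [SimpleGraph.Walk.length_cons] at h5
      omega
  choose p hp using hex
  refine ⟨p, fun v => G.dist v r, fun v hv => (hp v hv).2, ?_⟩
  have hsub : parentEdges r p Finset.univ ⊆ T.2 := by
    intro e he
    obtain ⟨v, hv, rfl⟩ := Finset.mem_image.1 he
    have := (hp v (Finset.ne_of_mem_erase hv)).1
    rw [hG, SimpleGraph.fromEdgeSet_adj] at this
    exact_mod_cast this.1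
  have hset : G.edgeSet = T.2 := by
    rw [hG, SimpleGraph.edgeSet_fromEdgeSet, sdiff_eq_left, Set.disjoint_left]
    intro e he
    have := h2 he
    rwa [SimpleGraph.edgeSet_top] at this
  have hcard := (SimpleGraph.isTree_iff_connected_and_card.1 h3).2
  rw [hset, Nat.card_coe_set_eq, Set.ncard_coe_finset, Nat.card_eq_fintype_card] at hcard
  have hinj : Set.InjOn (fun v => s(v, p v)) (Finset.univ.erase r : Finset V) := by
    intro v hv w hw hvw
    have hv := (hp v (Finset.ne_of_mem_erase hv)).2
    have hw := (hp w (Finset.ne_of_mem_erase hw)).2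
    rcases Sym2.eq_iff.1 hvw with h | ⟨h, h'⟩
    · exact h.1
    · rw [h'] at hv
      rw [← h] at hw
      omega
  have hpc : (parentEdges r p Finset.univ).card + 1 = Fintype.card V := by
    rw [parentEdges, Finset.card_image_of_injOn hinj,
      Finset.card_erase_add_one (Finset.mem_univ r), Finset.card_univ]
  exact Prod.ext h1 (Finset.eq_of_subset_of_card_le hsub (by omega)).symm

/-- The numbers of descendants satisfy the evident recursion. -/
theorem IsParent.exists_descendants {r : V} {p : V → V} {d : V → ℕ} (h : IsParent r p d) :
    ∃ D : V → ℕ, ∀ v, D v = 1 + ∑ c with c ≠ r ∧ p c = v, D c := by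
  -- `f k v` counts descendants within `k` generations; it is stable once `d v + k` reaches the
  -- maximal depth.
  let f : ℕ → V → ℕ := fun k => Nat.rec (fun _ => 1)
    (fun _ g v => 1 + ∑ c with c ≠ r ∧ p c = v, g c) k
  have hf : ∀ k v, f (k + 1) v = 1 + ∑ c with c ≠ r ∧ p c = v, f k c := fun _ _ => rfl
  have hN : ∀ v, d v ≤ Finset.univ.sup d := fun v => Finset.le_sup (Finset.mem_univ v)
  have hstab : ∀ k v, Finset.univ.sup d ≤ d v + k → f (k + 1) v = f k v := by
    intro k
    induction k with
    | zero =>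
      intro v hv
      rw [hf, Finset.filter_false_of_mem]
      · rfl
      · rintro c - ⟨hc, rfl⟩
        have := h c hc
        have := hN c
        omega
    | succ k ih =>
      intro v hv
      rw [hf (k + 1), hf k]
      congr 1
      refine Finset.sum_congr rfl fun c hc => ih c ?_
      obtain ⟨-, hcr, rfl⟩ := Finset.mem_filter.1 hc
      have := h c hcr
      omega
  exact ⟨f (Finset.univ.sup d), fun v => by
    conv_lhs => rw [← hstab _ v (by omega)]⟩

/-- In an ancestor-closed set `S`, the branches that leave `S` partition the complement. -/
theorem sum_descendants_boundary {r : V} {p : V → V} {D : V → ℕ}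
    (hD : ∀ v, D v = 1 + ∑ c with c ≠ r ∧ p c = v, D c) {S : Finset V} (hr : r ∈ S)
    (hS : ∀ v ∈ S, v ≠ r → p v ∈ S) : ∑ v ∈ Sᶜ with p v ∈ S, D v = Sᶜ.card := by
  have h1 : ∑ v ∈ Sᶜ, D v = Sᶜ.card + ∑ v ∈ Sᶜ, ∑ c with c ≠ r ∧ p c = v, D c := by
    rw [Finset.card_eq_sum_ones, ← Finset.sum_add_distrib]
    exact Finset.sum_congr rfl fun v _ => hD v
  have h2 : ∑ v ∈ Sᶜ, ∑ c with c ≠ r ∧ p c = v, D c = ∑ v ∈ Sᶜ with p v ∉ S, D v := by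
    rw [← Finset.sum_fiberwise_of_maps_to (s := Sᶜ.filter fun v => p v ∉ S) (t := Sᶜ) (g := p)
      fun v hv => Finset.mem_compl.2 (Finset.mem_filter.1 hv).2]
    refine Finset.sum_congr rfl fun v hv => Finset.sum_congr ?_ fun _ _ => rfl
    rw [Finset.mem_compl] at hv
    ext c
    simp only [Finset.mem_filter, Finset.mem_univ, true_and, Finset.mem_compl]
    constructor
    · rintro ⟨hc, rfl⟩
      exact ⟨⟨fun h => hv (hS c h hc), hv⟩, rfl⟩
    · rintro ⟨⟨hc, -⟩, rfl⟩
      exact ⟨fun h => hc (h ▸ hr), rfl⟩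
  have h3 := Finset.sum_filter_add_sum_filter_not Sᶜ (fun v => p v ∈ S) D
  omega

variable [Nonempty V]

/-- Growth never removes an edge, so a wrong anchor is fatal. For the right one, all children of `v`
are still missing and the recursion turns the sum into `D v`. The free factor `a` serves both the
induction and the first step from `{r}`. -/
theorem treeGrow_addLeaf_apply {r : V} {p : V → V} {D : V → ℕ}
    (hD : ∀ v, D v = 1 + ∑ c with c ≠ r ∧ p c = v, D c) {k : ℕ} {S : Finset V} {u v : V}
    {a : ENNReal} (hr : r ∈ S) (hS : ∀ w ∈ S, w ≠ r → p w ∈ S) (hv : v ∉ S) (hu : u ∈ S)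
    (h : p v ∈ S → treeGrow k v (insert v S, parentEdges r p (insert v S))
      (Finset.univ, parentEdges r p Finset.univ) =
        a * ((1 + ∑ c ∈ (insert v S)ᶜ with p c = v, D c : ℕ) : ENNReal)) :
    treeGrow k v (addLeaf (S, parentEdges r p S) u v)
      (Finset.univ, parentEdges r p Finset.univ) = if p v = u then a * (D v : ENNReal) else 0 := by
  have hvr : v ≠ r := fun h => hv (h ▸ hr)
  split_ifs with hpv
  · subst hpv
    have h1 : addLeaf (S, parentEdges r p S) (p v) v =
        (insert v S, parentEdges r p (insert v S)) := by
      simp only [addLeaf, parentEdges]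
      rw [Finset.erase_insert_of_ne hvr, Finset.image_insert, Sym2.eq_swap]
    have h2 : (insert v S)ᶜ.filter (fun c => p c = v) =
        Finset.univ.filter (fun c => c ≠ r ∧ p c = v) := by
      ext c
      simp only [Finset.mem_filter, Finset.mem_compl, Finset.mem_insert, Finset.mem_univ,
        true_and, not_or]
      constructor
      · rintro ⟨⟨-, hc⟩, rfl⟩
        exact ⟨fun h => hc (h ▸ hr), rfl⟩
      · rintro ⟨hc, rfl⟩
        refine ⟨⟨fun h => ?_, fun h => hv (hS c h hc)⟩, rfl⟩
        rw [← h] at hu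
        exact hv (h ▸ hu)
    rw [h1, h hu, h2, ← hD]
  · refine (PMF.apply_eq_zero_iff _ _).2 fun hsupp => ?_
    have hmem := subset_of_mem_support_treeGrow (by simp [addLeaf]) hsupp
      (Finset.mem_insert_self s(u, v) _)
    obtain ⟨w, hw, he⟩ := Finset.mem_image.1 hmem
    rcases Sym2.eq_iff.1 he with ⟨rfl, rfl⟩ | ⟨rfl, rfl⟩
    -- The edge could also join `u` to its parent `v`, but `S` is ancestor-closed.
    · exact hv (hS w hu (Finset.ne_of_mem_erase hw))
    · exact hpv rfl

/-- The probability that `treeGrow` completes a subtree to a given spanning tree. -/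
theorem treeGrow_apply_parentEdges {r : V} {p : V → V} {D : V → ℕ}
    (hD : ∀ v, D v = 1 + ∑ c with c ≠ r ∧ p c = v, D c) {k : ℕ} {S : Finset V} {x : V}
    (hr : r ∈ S) (hS : ∀ v ∈ S, v ≠ r → p v ∈ S) (hx : x ∈ S) (hk : Sᶜ.card ≤ k) :
    treeGrow k x (S, parentEdges r p S) (Finset.univ, parentEdges r p Finset.univ) =
      (Fintype.card V : ENNReal)⁻¹ ^ Sᶜ.card * ((1 + ∑ v ∈ Sᶜ with p v = x, D v : ℕ) : ENNReal) := by
  induction k generalizing S x with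
  | zero =>
    obtain rfl : S = Finset.univ := by simpa using hk
    simp [treeGrow]
  | succ k ih =>
    by_cases hne : Sᶜ.Nonempty
    swap
    · obtain rfl : S = Finset.univ := by simpa using hne
      rw [treeGrow_of_compl_eq_empty (by simp)]
      simp
    have hcard : ∀ v ∉ S, (insert v S)ᶜ.card + 1 = Sᶜ.card := fun v hv => by
      rw [Finset.compl_insert, Finset.card_erase_add_one (Finset.mem_compl.2 hv)]
    obtain ⟨q, hq⟩ : ∃ q, Sᶜ.card = q + 1 := ⟨Sᶜ.card - 1, by have := hne.card_pos; omega⟩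
    have hval : ∀ v ∈ Sᶜ, ∀ u ∈ S, treeGrow k v (addLeaf (S, parentEdges r p S) u v)
        (Finset.univ, parentEdges r p Finset.univ) =
          if p v = u then (Fintype.card V : ENNReal)⁻¹ ^ q * (D v : ENNReal) else 0 := by
      intro v hv u hu
      rw [Finset.mem_compl] at hv
      have h2 := hcard v hv
      rw [treeGrow_addLeaf_apply hD hr hS hv hu fun hpv => ih (Finset.mem_insert_of_mem hr)
        (fun w hw hwr => ?_) (Finset.mem_insert_self _ _) (by omega),
        show (insert v S)ᶜ.card = q by omega]
      rcases Finset.mem_insert.1 hw with rfl | hw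
      · exact Finset.mem_insert_of_mem hpv
      · exact Finset.mem_insert_of_mem (hS w hw hwr)
    have hsum1 : ∑ v ∈ Sᶜ, treeGrow k v (addLeaf (S, parentEdges r p S) x v)
        (Finset.univ, parentEdges r p Finset.univ) = (Fintype.card V : ENNReal)⁻¹ ^ q *
          ((∑ v ∈ Sᶜ with p v = x, D v : ℕ) : ENNReal) := by
      rw [Finset.sum_congr rfl fun v hv => hval v hv x hx, ← Finset.sum_filter, ← Finset.mul_sum,
        Nat.cast_sum]
    have hsum2 : ∑ v ∈ Sᶜ, ∑ u ∈ S, treeGrow k v (addLeaf (S, parentEdges r p S) u v)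
        (Finset.univ, parentEdges r p Finset.univ) = (Fintype.card V : ENNReal)⁻¹ ^ q *
          (Sᶜ.card : ENNReal) := by
      rw [← sum_descendants_boundary hD hr hS, Nat.cast_sum, Finset.mul_sum, Finset.sum_filter]
      refine Finset.sum_congr rfl fun v hv => ?_
      rw [Finset.sum_congr rfl fun u hu => hval v hv u hu, Finset.sum_ite_eq]
    rw [treeGrow_succ_apply hx hne, hsum1, hsum2, mul_left_comm (Sᶜ.card : ENNReal)⁻¹,
      ENNReal.inv_mul_cancel (by simp [hq]) (by simp), hq, pow_succ']
    push_cast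
    ring

end RootedTree

theorem mainTheorem7 (n : ℕ) [NeZero n] (r : Fin n) :
    IsUniformSpanningTree (⊤ : SimpleGraph (Fin n)) (urnTree r (n - 1)) := by
  by_cases h : (Finset.univ.erase r).Nonempty
  · rw [urnTree_eq_bind_treeGrow r h]
    -- After the first leaf, `n - 2` vertices are missing, each costing a factor `1/n`.
    refine .of_const ((n : ENNReal)⁻¹ ^ (n - 2)) (fun T hT => ?_) fun T hT => ?_
    · obtain ⟨p, d, hp, rfl⟩ := exists_parent_of_mem_spanningTrees hT r
      obtain ⟨D, hD⟩ := hp.exists_descendants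
      have hroot : (({r}, ∅) : Finset (Fin n) × Finset (Sym2 (Fin n))) =
          ({r}, parentEdges r p {r}) := by simp [parentEdges]
      have hS : ∀ w ∈ ({r} : Finset (Fin n)), w ≠ r → p w ∈ ({r} : Finset (Fin n)) :=
        fun w hw hwr => absurd (Finset.mem_singleton.1 hw) hwr
      have hsum := sum_descendants_boundary hD (Finset.mem_singleton_self r) hS
      simp only [Finset.mem_singleton, Finset.compl_singleton] at hsum
      have hval : ∀ v ∈ Finset.univ.erase r, treeGrow n v (addLeaf ({r}, ∅) r v)
          (Finset.univ, parentEdges r p Finset.univ) =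
            if p v = r then (n : ENNReal)⁻¹ ^ (n - 2) * (D v : ENNReal) else 0 := by
        intro v hv
        have hv := Finset.ne_of_mem_erase hv
        have hcard : (insert v ({r} : Finset (Fin n)))ᶜ.card = n - 2 := by
          rw [Finset.card_compl, Finset.card_pair hv, Fintype.card_fin]
        rw [hroot]
        refine treeGrow_addLeaf_apply hD (Finset.mem_singleton_self r) hS (by simpa using hv)
          (Finset.mem_singleton_self r) fun hpv => ?_
        rw [treeGrow_apply_parentEdges hD (by simp) (fun w hw hwr => ?_) (by simp) (by omega),
          hcard, Fintype.card_fin]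
        rcases Finset.mem_insert.1 hw with rfl | hw
        · exact Finset.mem_insert_of_mem hpv
        · exact Finset.mem_insert_of_mem (hS w hw hwr)
      rw [PMF.uniformOfFinset_bind_apply, Finset.sum_congr rfl hval, ← Finset.sum_filter,
        ← Finset.mul_sum, ← Nat.cast_sum, hsum, mul_left_comm,
        ENNReal.inv_mul_cancel (Nat.cast_ne_zero.2 h.card_pos.ne') (by simp), mul_one]
    · refine (PMF.apply_eq_zero_iff _ _).2 fun hsupp => hT ?_
      obtain ⟨v, hv, hsupp⟩ := (PMF.mem_support_bind_iff _ _ _).1 hsupp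
      have hv := Finset.ne_of_mem_erase ((PMF.mem_support_uniformOfFinset_iff _ _).1 hv)
      refine mem_spanningTrees_of_mem_support_treeGrow (by simp [addLeaf]) ?_
        ((IsGrownFrom.singleton r).addLeaf (by simp) (by simpa using hv)) hsupp
      exact (Finset.card_le_univ _).trans (by simp)
  -- Here `n = 1`, and the single vertex is the only spanning tree.
  · rw [urnTree_eq_pure r h]
    have huniv : ({r} : Finset (Fin n)) = Finset.univ := by
      rw [← Finset.insert_erase (Finset.mem_univ r), Finset.not_nonempty_iff_eq_empty.1 h]
      rfl
    refine .of_const 1 (fun T hT => ?_) fun T hT => ?_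
    · obtain ⟨p, d, -, rfl⟩ := exists_parent_of_mem_spanningTrees hT r
      rw [← huniv]
      simp [parentEdges]
    · refine (PMF.apply_eq_zero_iff _ _).2 fun hsupp => hT ?_
      rw [PMF.support_pure, Set.mem_singleton_iff] at hsupp
      rw [hsupp]
      exact (IsGrownFrom.singleton r).mem_spanningTrees huniv
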